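/- Conventions. Let $D=\mathbb R$ or $D=\mathbb R^+=(0,\infty)$. A submultiplicative weight is a continuous function $v:\mathbb R\to(0,\infty)$ with $v(x+y)\le v(x)v(y)$ for all $x,y$. A function $w:\mathbb R\to(0,\infty)$ is $v$-moderate with constant $C>0$ if $w(x+y)\le C\,v(x)\,w(y)$ for all $x,y\in\mathbb R$. A bijection $F:D\to\mathbb R$ is a warping function if $F\in\mathcal C^1(D)$, $F'>0$, $|t_0|<|t_1|$ implies $F'(t_1)\le F'(t_0)$ for $t_0,t_1\in D$, the weight $w=(F^{-1})'=1/F'(F^{-1}(\cdot))$ is $v$-moderate for some submultiplicative weight $v$ and some constant $C>0$, and, if $D=\mathbb R$, $F$ is odd. For a measurable $\theta:\mathbb R\to\mathbb C$ and factors $a=(a_m)_{m\in\mathbb Z}$, $a_m>0$, let $g_m(t)=\sqrt{a_m}\,\theta(F(t)-m)$ for $t\in D$ and $g_m(t)=0$ for $t\notin D$. If all $g_m$ are in $L^2(\mathbb R)$, the warped filter bank is $$\mathcal G(\theta,F,a)=\big(T_{na_m}\mathcal F^{-1}g_m\big)_{m,n\in\mathbb Z},\qquad (T_xf)(t)=f(t-x),$$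 where $\mathcal F$ is the unitary Fourier transform on $L^2(\mathbb R)$ with $\mathcal Ff(\xi)=\int f(t)e^{-2\pi it\xi}\,dt$ for $f\in L^1\cap L^2$. Let $H_D=\mathcal F^{-1}(L^2(D))=\{f\in L^2(\mathbb R):\mathcal Ff=0\text{ a.e. outside }D\}$. A family $(h_i)_i$ in $H_D$ is a Bessel sequence for $H_D$ if there is $0<B'<\infty$ with $\sum_i|\langle f,h_i\rangle|^2\le B'\|f\|^2$ for all $f\in H_D$; it is a frame for $H_D$ if there are $0<A'\le B'<\infty$ with $A'\|f\|^2\le\sum_i|\langle f,h_i\rangle|^2\le B'\|f\|^2$ for all $f\in H_D$. Theorem. Let $F:D\to\mathbb R$ be a warping function with $w=(F^{-1})'$. Let $\theta:\mathbb R\to\mathbb C$ be measurable and suppose that for some $\epsilon>0$, as $|t|\to\infty$, both $$\theta(t)=\mathcal O\big((1+|t|)^{-1-\epsilon}\big)\quad\text{and}\quad\theta(t)=\mathcal O\big((1+|F^{-1}(t)|)^{-1-\epsilon}\big),$$ and that there are constants $0<A\le B<\infty$ with $A\le\sum_{m\in\mathbb Z}|\theta(t-m)|^2\le B$ for almost every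 $t\in\mathbb R$. Then: (1) For every submultiplicative weight $v$ and constant $C>0$ such that $w$ is $v$-moderate with constant $C$, and for every $\tilde a>0$, with the natural downsampling factors $a_m=\tilde a/(C\,v(m))$, all $g_m$ are in $L^2(\mathbb R)$ and $\mathcal G(\theta,F,a)$ is a Bessel sequence for $H_D$. (2) There is $\tilde a_0>0$ such that for every such $v$ and $C$ and every $0<\tilde a\le\tilde a_0$, with $a_m=\tilde a/(C\,v(m))$, $\mathcal G(\theta,F,a)$ is a frame for $H_D$. -/

import Mathlib

open MeasureTheory Set Filter Asymptotics
open scoped FourierTransform ENNReal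

namespace WarpedFilterBank

noncomputable section

/-- A submultiplicative weight function: a continuous `v : ℝ → ℝ⁺` with
`v (x + y) ≤ v x * v y`. -/
structure IsSubmultiplicativeWeight (v : ℝ → ℝ) : Prop where
  continuous : Continuous v
  pos : ∀ x, 0 < v x
  submul : ∀ x y, v (x + y) ≤ v x * v y

/-- The function `w` is `v`-moderate with constant `C > 0`, for the submultiplicative
weight function `v`. -/
structure IsModerateWith (w v : ℝ → ℝ) (C : ℝ) : Prop where
  weight : IsSubmultiplicativeWeight v
  const_pos : 0 < C
  le_mul : ∀ x y, w (x + y) ≤ C * v x * w y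

/-- The inverse `F⁻¹ : ℝ → D` of a bijection `F : D → ℝ`. The function `F` is given on all of `ℝ`;
only its values on `D` matter. -/
def warpInv (D : Set ℝ) (F : ℝ → ℝ) : ℝ → ℝ := Function.invFunOn F D

/-- The associated weight `w(t) = (F⁻¹)'(t) = 1 / F'(F⁻¹(t))`. -/
def warpWeight (D : Set ℝ) (F : ℝ → ℝ) (t : ℝ) : ℝ := 1 / deriv F (warpInv D F t)

/-- Warping functions `F : D → ℝ`, with `D = ℝ` or `D = ℝ⁺ = (0, ∞)`. -/
structure IsWarpingFunction (D : Set ℝ) (F : ℝ → ℝ) : Prop where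
  domain : D = univ ∨ D = Ioi 0
  bijOn : BijOn F D univ
  contDiffOn : ContDiffOn ℝ 1 F D
  deriv_pos : ∀ t ∈ D, 0 < deriv F t
  deriv_anti : ∀ t₀ ∈ D, ∀ t₁ ∈ D, |t₀| < |t₁| → deriv F t₁ ≤ deriv F t₀
  moderate : ∃ (v : ℝ → ℝ) (C : ℝ), IsModerateWith (warpWeight D F) v C
  odd : D = univ → ∀ t, F (-t) = -F t

/-- The Hilbert space `L²(ℝ)`. -/
abbrev L2 : Type := Lp ℂ 2 (volume : Measure ℝ)

/-- Translation `(T_x f)(t) = f(t - x)` on `L²(ℝ)`. -/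
def translateL2 (x : ℝ) (f : L2) : L2 :=
  Lp.compMeasurePreserving (fun t : ℝ => t - x) (measurePreserving_sub_right volume x) f

/-- The signal space `𝓕⁻¹(L²(D))`: all `f ∈ L²(ℝ)` whose Fourier transform vanishes almost
everywhere outside `D`. -/
def signalSpace (D : Set ℝ) : Submodule ℂ L2 where
  carrier := {f | ∀ᵐ ξ : ℝ, ξ ∉ D → (𝓕 f : L2) ξ = 0}
  add_mem' := by
    intro f g hf hg
    have h : (𝓕 (f + g) : L2) = 𝓕 f + 𝓕 g := FourierTransform.fourier_add f g
    simp only [mem_ofPred_eq] at hf hg ⊢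
    rw [h]
    filter_upwards [hf, hg, Lp.coeFn_add (𝓕 f : L2) (𝓕 g)] with ξ h1 h2 h3 h4
    rw [h3, Pi.add_apply, h1 h4, h2 h4, add_zero]
  zero_mem' := by
    have h : (𝓕 (0 : L2) : L2) = 0 := (Lp.fourierTransformₗᵢ ℝ ℂ).map_zero
    simp only [mem_ofPred_eq]
    rw [h]
    filter_upwards [Lp.coeFn_zero ℂ 2 (volume : Measure ℝ)] with ξ h1 _
    rw [h1, Pi.zero_apply]
  smul_mem' := by
    intro c f hf
    have h : (𝓕 (c • f) : L2) = c • 𝓕 f := FourierTransform.fourier_smul c f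
    simp only [mem_ofPred_eq] at hf ⊢
    rw [h]
    filter_upwards [hf, Lp.coeFn_smul c (𝓕 f : L2)] with ξ h1 h2 h3
    rw [h2, Pi.smul_apply, h1 h3, smul_zero]

/-- The filter bank `(T_{n a_m} 𝓕⁻¹ g_m)_{m,n ∈ ℤ}` with frequency responses `g_m` and
downsampling factors `a_m`. -/
def filterBank (g : ℤ → L2) (a : ℤ → ℝ) : ℤ × ℤ → L2 :=
  fun p => translateL2 (p.2 * a p.1) (𝓕⁻ (g p.1))

/-- The frequency responses `g_m = √a_m · (T_m θ) ∘ F` on `D`, extended by zero to `ℝ`. -/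
def warpedResponse (D : Set ℝ) (F : ℝ → ℝ) (θ : ℝ → ℂ) (a : ℤ → ℝ) (m : ℤ) : ℝ → ℂ :=
  D.indicator fun t => (Real.sqrt (a m) : ℂ) * θ (F t - m)

/-- The warped filter bank `𝒢(θ, F, a)`, for frequency responses in `L²`. -/
def warpedFilterBank (D : Set ℝ) (F : ℝ → ℝ) (θ : ℝ → ℂ) (a : ℤ → ℝ)
    (h : ∀ m, MemLp (warpedResponse D F θ a m) 2 volume) : ℤ × ℤ → L2 :=
  filterBank (fun m => (h m).toLp (warpedResponse D F θ a m)) a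

/-- Natural downsampling factors `a_m = ã / (C v(m))`. -/
def naturalFactors (v : ℝ → ℝ) (C atil : ℝ) (m : ℤ) : ℝ := atil / (C * v m)

/-- The family `g` lies in the subspace `K` and is a Bessel sequence for `K`. -/
def IsBesselSequence {H ι : Type*} [NormedAddCommGroup H] [InnerProductSpace ℂ H]
    (K : Submodule ℂ H) (g : ι → H) : Prop :=
  (∀ i, g i ∈ K) ∧ ∃ B : ℝ, 0 < B ∧ ∀ f ∈ K,
    ∑' i, ‖inner ℂ f (g i)‖ₑ ^ 2 ≤ ENNReal.ofReal (B * ‖f‖ ^ 2)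

/-- The family `g` lies in the subspace `K` and is a frame for `K`. -/
def IsFrame {H ι : Type*} [NormedAddCommGroup H] [InnerProductSpace ℂ H]
    (K : Submodule ℂ H) (g : ι → H) : Prop :=
  (∀ i, g i ∈ K) ∧ ∃ A B : ℝ, 0 < A ∧ A ≤ B ∧ ∀ f ∈ K,
    ENNReal.ofReal (A * ‖f‖ ^ 2) ≤ ∑' i, ‖inner ℂ f (g i)‖ₑ ^ 2 ∧
    ∑' i, ‖inner ℂ f (g i)‖ₑ ^ 2 ≤ ENNReal.ofReal (B * ‖f‖ ^ 2)

end

end WarpedFilterBank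

namespace WarpedFilterBank

/-! On the Fourier side a translate of a channel is a modulation, so the coefficients of `f` in
channel `m` are, up to the factor `1/a_m`, the Fourier coefficients of the periodization, with
period `L = 1/a_m`, of `g_m` times the conjugate of `𝓕 f`. Parseval turns their sum of squares into
`L` times the integral of the squared periodization over one period. Expanding that square gives a
diagonal part, which weights `|𝓕 f|²` by `|g_m|²/a_m`, and cross terms between `ξ` and `ξ + jL`, `j
≠ 0`, which a Schur argument bounds by weighting `|𝓕 f|²` again (`channel_bounds`,
`filterBank_bounds`).

Summed over `m`, the diagonal weight at `ξ ∈ D` is exactly `∑ |θ(F ξ - m)|²`, between `A` and `B`.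
Everything rests on the cross terms. Write `G` for the inverse of `F`. Integrating moderateness
gives `|ξ - η| ≤ C v(m) |G(F ξ - m) - G(F η - m)|`. With `a_m = b/(C v(m))` the shift `L` is `C
v(m)/b`, so the points `x_j = G(F(ξ + jL) - m)` are `1/b`-separated, whatever `m`, `v` and `C` are.
Decay of `θ` in the variable `G` makes the sum over `j` finite, decay in the variable itself makes
the sum over `m` finite, and a surplus `ε/2` of the decay in `G`, spent on the separation, yields a
factor `b^(ε/2)`.

The off-diagonal bound is therefore always finite, which gives the Bessel property. It is at most
`A/2` for small `b`, which leaves a lower frame bound `A/2`. -/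

/-! ### Translation and modulation on the Fourier side -/

/-- The modulation factor `ξ ↦ exp (-2πi x ξ)`. -/
noncomputable def modFactor (x ξ : ℝ) : ℂ := Complex.exp (-(2 * Real.pi * Complex.I * x * ξ))

lemma norm_modFactor (x ξ : ℝ) : ‖modFactor x ξ‖ = 1 := by
  rw [modFactor, show -(2 * Real.pi * Complex.I * x * ξ : ℂ) =
    ((-(2 * Real.pi * x * ξ) : ℝ) : ℂ) * Complex.I by push_cast; ring]
  exact Complex.norm_exp_ofReal_mul_I _

@[fun_prop]
lemma continuous_modFactor (x : ℝ) : Continuous (modFactor x) := by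
  unfold modFactor; fun_prop

lemma memLp_modFactor_mul (x : ℝ) (f : L2) : MemLp (fun ξ => modFactor x ξ * f ξ) 2 volume := by
  refine (Lp.memLp f).of_le_mul (c := 1)
    ((continuous_modFactor x).aestronglyMeasurable.mul (Lp.aestronglyMeasurable f)) ?_
  filter_upwards with ξ
  simp [norm_modFactor]

/-- Modulation on `L²(ℝ)`. -/
noncomputable def modulateL2 (x : ℝ) (f : L2) : L2 := (memLp_modFactor_mul x f).toLp _

lemma coeFn_modulateL2 (x : ℝ) (f : L2) :
    (modulateL2 x f : ℝ → ℂ) =ᵐ[volume] fun ξ => modFactor x ξ * f ξ := MemLp.coeFn_toLp _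

lemma isometry_modulateL2 (x : ℝ) : Isometry (modulateL2 x) := by
  intro f g
  rw [Lp.edist_def, Lp.edist_def]
  refine eLpNorm_congr_norm_ae ?_
  filter_upwards [coeFn_modulateL2 x f, coeFn_modulateL2 x g] with ξ hf hg
  simp only [Pi.sub_apply]
  rw [hf, hg, ← mul_sub, norm_mul, norm_modFactor, one_mul]

lemma isometry_translateL2 (x : ℝ) : Isometry (translateL2 x) :=
  Lp.isometry_compMeasurePreserving (measurePreserving_sub_right volume x)

lemma fourier_comp_sub (f : ℝ → ℂ) (x ξ : ℝ) :
    𝓕 (fun t => f (t - x)) ξ = modFactor x ξ * 𝓕 f ξ := by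
  have h := congrFun (VectorFourier.fourierIntegral_comp_add_right Real.fourierChar volume
    (innerₗ ℝ) f (-x)) ξ
  simp only [Function.comp_def, ← sub_eq_add_neg] at h
  refine h.trans ?_
  rw [Circle.smul_def, Real.fourierChar_apply, smul_eq_mul, modFactor]
  congr 2
  simp
  ring

/-- The Fourier transform turns translations into modulations. -/
lemma fourier_translateL2 (x : ℝ) (f : L2) : 𝓕 (translateL2 x f) = modulateL2 x (𝓕 f) := by
  refine DenseRange.induction_on (p := fun f : L2 => 𝓕 (translateL2 x f) = modulateL2 x (𝓕 f))
    (SchwartzMap.denseRange_toLpCLM (p := 2) ENNReal.ofNat_ne_top) f ?_ ?_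
  · exact isClosed_eq
      ((Lp.fourierTransformₗᵢ ℝ ℂ).continuous.comp (isometry_translateL2 x).continuous)
      ((isometry_modulateL2 x).continuous.comp (Lp.fourierTransformₗᵢ ℝ ℂ).continuous)
  intro s
  change 𝓕 (translateL2 x (s.toLp 2)) = modulateL2 x (𝓕 (s.toLp 2))
  have h1 : translateL2 x (s.toLp 2) = (s.compSubConstCLM ℂ x).toLp 2 := by
    ext1
    refine (Lp.coeFn_compMeasurePreserving _ (measurePreserving_sub_right volume x)).trans ?_
    refine ((measurePreserving_sub_right volume x).quasiMeasurePreserving.ae_eq_comp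
      (s.coeFn_toLp 2 volume)).trans ?_
    filter_upwards [(s.compSubConstCLM ℂ x).coeFn_toLp 2 volume] with t ht
    rw [ht]
    rfl
  rw [h1, SchwartzMap.toLp_fourier_eq, SchwartzMap.toLp_fourier_eq]
  ext1
  filter_upwards [SchwartzMap.coeFn_toLp (𝓕 (s.compSubConstCLM ℂ x)) 2 volume,
    coeFn_modulateL2 x ((𝓕 s).toLp 2), SchwartzMap.coeFn_toLp (𝓕 s) 2 volume] with ξ e1 e2 e3
  rw [e1, e2, e3, SchwartzMap.fourier_coe, SchwartzMap.fourier_coe]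
  exact fourier_comp_sub s x ξ

lemma inner_translateL2_fourierInv (x : ℝ) (f g : L2) :
    inner ℂ f (translateL2 x (𝓕⁻ g)) =
      ∫ ξ, modFactor x ξ * (g ξ * (starRingEnd ℂ) ((𝓕 f : L2) ξ)) := by
  rw [← Lp.inner_fourier_eq, fourier_translateL2, FourierTransform.fourier_fourierInv_eq,
    L2.inner_def]
  refine integral_congr_ae ?_
  filter_upwards [coeFn_modulateL2 x g] with ξ h
  rw [h, RCLike.inner_apply]
  ring

lemma translateL2_fourierInv_mem_signalSpace {D : Set ℝ} (x : ℝ) {g : L2}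
    (hg : ∀ᵐ ξ, ξ ∉ D → g ξ = 0) : translateL2 x (𝓕⁻ g) ∈ signalSpace D := by
  change ∀ᵐ ξ : ℝ, ξ ∉ D → (𝓕 (translateL2 x (𝓕⁻ g)) : L2) ξ = 0
  rw [fourier_translateL2, FourierTransform.fourier_fourierInv_eq]
  filter_upwards [hg, coeFn_modulateL2 x g] with ξ h1 h2 h3
  rw [h2, h1 h3, mul_zero]

/-! ### Periodization -/

lemma lintegral_eq_lintegral_periodization {L : ℝ} (hL : 0 < L) {u : ℝ → ℝ≥0∞}
    (hu : AEMeasurable u) :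
    ∫⁻ ξ, u ξ = ∫⁻ ξ in Ioc 0 L, ∑' k : ℤ, u (ξ + k * L) := by
  have hmp (k : ℤ) : MeasurePreserving (fun ξ : ℝ => ξ + k * L) volume volume :=
    measurePreserving_add_right volume _
  have hm (k : ℤ) : AEMeasurable (fun ξ => u (ξ + k * L)) (volume.restrict (Ioc 0 L)) :=
    (hu.comp_quasiMeasurePreserving (hmp k).quasiMeasurePreserving).restrict
  rw [lintegral_tsum hm,
    ← setLIntegral_univ, ← iUnion_Ioc_add_zsmul hL 0,
    lintegral_iUnion (fun _ => measurableSet_Ioc) (pairwise_disjoint_Ioc_add_zsmul 0 L)]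
  refine tsum_congr fun k => ?_
  have h := (hmp k).setLIntegral_comp_preimage_emb (measurableEmbedding_addRight _) u
    (Ioc (0 + k • L) (0 + (k + 1) • L))
  rw [← h]
  congr 2
  ext ξ
  simp only [mem_preimage, mem_Ioc, zsmul_eq_mul, zero_add]
  push_cast
  constructor <;> rintro ⟨h1, h2⟩ <;> constructor <;> linarith

/-- The `L`-periodization of `h`. -/
noncomputable def periodization (L : ℝ) (h : ℝ → ℂ) (ξ : ℝ) : ℂ := ∑' k : ℤ, h (ξ + k * L)

/-- By Tonelli, the series of norms has finite integral over one period, hence is finite almost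
everywhere. -/
lemma ae_summable_periodization {L : ℝ} (hL : 0 < L) {h : ℝ → ℂ} (hh : Integrable h) :
    ∀ᵐ ξ ∂(volume.restrict (Ioc 0 L)), Summable fun k : ℤ => ‖h (ξ + k * L)‖ := by
  have h1 : ∫⁻ ξ in Ioc 0 L, ∑' k : ℤ, ‖h (ξ + k * L)‖ₑ ≠ ∞ := by
    rw [← lintegral_eq_lintegral_periodization hL hh.aestronglyMeasurable.enorm]
    exact hh.hasFiniteIntegral.ne
  have hm : AEMeasurable (fun ξ => ∑' k : ℤ, ‖h (ξ + k * L)‖ₑ) (volume.restrict (Ioc 0 L)) :=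
    AEMeasurable.tsum fun k => (hh.aestronglyMeasurable.enorm.comp_quasiMeasurePreserving
      (measurePreserving_add_right volume (k * L)).quasiMeasurePreserving).restrict
  filter_upwards [ae_lt_top' hm h1] with ξ hξ
  have := ENNReal.summable_toReal hξ.ne
  simpa using this

lemma aestronglyMeasurable_periodization (L : ℝ) {h : ℝ → ℂ} (hh : AEStronglyMeasurable h) :
    AEStronglyMeasurable (periodization L h) := by
  have : AEMeasurable (fun ξ => ∑' k : ℤ, h (ξ + k * L)) :=
    AEMeasurable.tsum fun k => hh.aemeasurable.comp_quasiMeasurePreserving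
      (measurePreserving_add_right volume (k * L)).quasiMeasurePreserving
  exact this.aestronglyMeasurable

lemma integral_eq_integral_periodization {L : ℝ} (hL : 0 < L) {h : ℝ → ℂ} (hh : Integrable h) :
    ∫ ξ, h ξ = ∫ ξ in Ioc 0 L, periodization L h ξ := by
  have hmp (k : ℤ) : MeasurePreserving (fun ξ : ℝ => ξ + k * L) volume volume :=
    measurePreserving_add_right volume _
  simp only [periodization]
  rw [integral_tsum]
  · rw [← setIntegral_univ, ← iUnion_Ioc_add_zsmul hL 0,
      integral_iUnion (fun _ => measurableSet_Ioc) (pairwise_disjoint_Ioc_add_zsmul 0 L)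
        hh.integrableOn]
    refine tsum_congr fun k => ?_
    have h := (hmp k).setIntegral_preimage_emb (measurableEmbedding_addRight _) h
      (Ioc (0 + k • L) (0 + (k + 1) • L))
    rw [← h]
    congr 2
    ext ξ
    simp only [mem_preimage, mem_Ioc, zsmul_eq_mul, zero_add]
    push_cast
    constructor <;> rintro ⟨h1, h2⟩ <;> constructor <;> linarith
  · exact fun k => (hh.aestronglyMeasurable.comp_quasiMeasurePreserving
      (hmp k).quasiMeasurePreserving).restrict
  · have hm (k : ℤ) : AEMeasurable (fun ξ => ‖h (ξ + k * L)‖ₑ) (volume.restrict (Ioc 0 L)) :=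
      (hh.aestronglyMeasurable.enorm.comp_quasiMeasurePreserving
        (hmp k).quasiMeasurePreserving).restrict
    rw [← lintegral_tsum hm,
      ← lintegral_eq_lintegral_periodization hL hh.aestronglyMeasurable.enorm]
    exact hh.hasFiniteIntegral.ne

/-- This periodicity lets the modulation be pulled out of the periodizing sum, which turns an
integral over `ℝ` into a Fourier coefficient. -/
lemma modFactor_add_int_mul {a L : ℝ} (haL : a * L = 1) (n k : ℤ) (ξ : ℝ) :
    modFactor (n * a) (ξ + k * L) = modFactor (n * a) ξ := by
  rw [modFactor, modFactor, Complex.exp_eq_exp_iff_exists_int]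
  refine ⟨-(n * k), ?_⟩
  have : (a : ℂ) * L = 1 := by exact_mod_cast haL
  push_cast
  linear_combination (-(2 * Real.pi * Complex.I * n * k : ℂ)) * this

/-- Parseval's identity for the periodization of an integrable function. -/
lemma tsum_enorm_sq_integral_modFactor {a L : ℝ} (hL : 0 < L) (haL : a * L = 1) {h : ℝ → ℂ}
    (hh : Integrable h) (h2 : ∫⁻ ξ in Ioc 0 L, ‖periodization L h ξ‖ₑ ^ 2 ≠ ∞) :
    ∑' n : ℤ, ‖∫ ξ, modFactor (n * a) ξ * h ξ‖ₑ ^ 2 =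
      ENNReal.ofReal L * ∫⁻ ξ in Ioc 0 L, ‖periodization L h ξ‖ₑ ^ 2 := by
  have hmem : MemLp (periodization L h) 2 (volume.restrict (Ioc 0 L)) := by
    refine ⟨(aestronglyMeasurable_periodization L hh.aestronglyMeasurable).restrict, ?_⟩
    rw [eLpNorm_lt_top_iff_lintegral_rpow_enorm_lt_top (by norm_num) (by norm_num)]
    simpa using h2.lt_top
  have key (n : ℤ) : ∫ ξ, modFactor (n * a) ξ * h ξ =
      L * fourierCoeffOn hL (periodization L h) n := by
    rw [integral_eq_integral_periodization hL
      (hh.bdd_mul (c := 1) (continuous_modFactor _).aestronglyMeasurable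
        (Eventually.of_forall fun ξ => (norm_modFactor _ _).le)), fourierCoeffOn_eq_integral,
      intervalIntegral.integral_of_le hL.le, sub_zero, Complex.real_smul, ← mul_assoc]
    have : (L : ℂ) * ((1 / L : ℝ) : ℂ) = 1 := by
      rw [← Complex.ofReal_mul, mul_one_div_cancel hL.ne', Complex.ofReal_one]
    rw [this, one_mul]
    congr 1 with ξ
    simp only [periodization, modFactor_add_int_mul haL]
    rw [tsum_mul_left, fourier_coe_apply, smul_eq_mul, modFactor]
    congr 2
    have h3 : (a : ℂ) * L = 1 := by exact_mod_cast haL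
    have h4 : (L : ℂ) ≠ 0 := by exact_mod_cast hL.ne'
    push_cast
    field_simp
    linear_combination (-(n * ξ : ℂ)) * h3
  have hs := hasSum_sq_fourierCoeffOn hL hmem
  have hint : Integrable (fun ξ => ‖periodization L h ξ‖ ^ 2) (volume.restrict (Ioc 0 L)) :=
    hmem.integrable_norm_pow (by norm_num)
  have e1 (z : ℂ) : ‖z‖ₑ ^ 2 = ENNReal.ofReal (‖z‖ ^ 2) := by
    rw [ENNReal.ofReal_pow (norm_nonneg _), ofReal_norm]
  simp_rw [key, e1, norm_mul, mul_pow]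
  rw [← ofReal_integral_eq_lintegral_ofReal hint (Eventually.of_forall fun _ => by positivity),
    ← ENNReal.ofReal_mul hL.le]
  have hs' := (hs.mul_left (‖(L : ℂ)‖ ^ 2))
  rw [← ENNReal.ofReal_tsum_of_nonneg (fun n => by positivity) hs'.summable, hs'.tsum_eq,
    intervalIntegral.integral_of_le hL.le, Complex.norm_real, Real.norm_of_nonneg hL.le, sub_zero,
    smul_eq_mul]
  congr 1
  field_simp

/-! ### Diagonal and off-diagonal parts of the filter bank -/

/-- Expand `S * conj S` row by row: in row `k`, reindex `conj S` by `i = k + j` and separate `j =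
0`. The remainder is bounded by the triangle inequality. Both directions are stated additively,
since subtraction in `ℝ≥0∞` truncates. -/
lemma tsum_enorm_sq_offDiag {z : ℤ → ℂ} (hz : Summable fun k => ‖z k‖) :
    ‖∑' k, z k‖ₑ ^ 2 ≤ ∑' k, ‖z k‖ₑ ^ 2 +
        ∑' k, ∑' j : ({0}ᶜ : Set ℤ), ‖z k‖ₑ * ‖z (k + j)‖ₑ ∧
      ∑' k, ‖z k‖ₑ ^ 2 ≤ ‖∑' k, z k‖ₑ ^ 2 +
        ∑' k, ∑' j : ({0}ᶜ : Set ℤ), ‖z k‖ₑ * ‖z (k + j)‖ₑ := by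
  set S := ∑' k, z k with hS
  have hshift (k : ℤ) : Summable fun j : ℤ => ‖z (k + j)‖ :=
    (Equiv.addLeft k).summable_iff.mpr hz
  have hrow (k : ℤ) : (starRingEnd ℂ) S = (starRingEnd ℂ) (z k) +
      ∑' j : ({0}ᶜ : Set ℤ), (starRingEnd ℂ) (z (k + j)) := by
    have h1 : Summable fun j : ℤ => (starRingEnd ℂ) (z (k + j)) :=
      .of_norm (by simpa using hshift k)
    have h2 : ∑' i, (starRingEnd ℂ) (z i) = ∑' j, (starRingEnd ℂ) (z (k + j)) :=
      ((Equiv.addLeft k).tsum_eq fun i => (starRingEnd ℂ) (z i)).symm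
    rw [hS, Complex.conj_tsum, h2,
      ← Summable.tsum_add_tsum_compl (s := {0}) (h1.subtype _) (h1.subtype _),
      tsum_singleton 0 fun j => (starRingEnd ℂ) (z (k + j)), add_zero]
  set e : ℤ → ℂ := fun k => z k * ∑' j : ({0}ᶜ : Set ℤ), (starRingEnd ℂ) (z (k + j)) with he
  have hd : Summable fun k => z k * (starRingEnd ℂ) (z k) := by
    refine .of_norm ?_
    have h1 := (hz.mul_norm hz).comp_injective
      (i := fun k : ℤ => (k, k)) fun _ _ h => congrArg Prod.fst h
    refine h1.congr fun k => ?_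
    simp
  have hzS : Summable fun k => z k * (starRingEnd ℂ) S := hz.of_norm.mul_right _
  have hsplit (k : ℤ) : z k * (starRingEnd ℂ) S = z k * (starRingEnd ℂ) (z k) + e k := by
    rw [hrow k, mul_add]
  have hes : Summable e := by
    refine (hzS.sub hd).congr fun k => ?_
    rw [hsplit, add_sub_cancel_left]
  have hmain : S * (starRingEnd ℂ) S = ∑' k, z k * (starRingEnd ℂ) (z k) + ∑' k, e k := by
    rw [← hd.tsum_add hes, ← tsum_congr hsplit, tsum_mul_right]
  have hE : ‖∑' k, e k‖ₑ ≤ ∑' k, ∑' j : ({0}ᶜ : Set ℤ), ‖z k‖ₑ * ‖z (k + j)‖ₑ := by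
    refine enorm_tsum_le_tsum_enorm.trans (ENNReal.tsum_le_tsum fun k => ?_)
    rw [ENNReal.tsum_mul_left, he]
    simp only [enorm_mul]
    gcongr
    refine enorm_tsum_le_tsum_enorm.trans_eq (tsum_congr fun j => ?_)
    rw [← ofReal_norm, ← ofReal_norm, RCLike.norm_conj]
  have hSS : ‖S * (starRingEnd ℂ) S‖ₑ = ‖S‖ₑ ^ 2 := by
    rw [enorm_mul, pow_two, ← ofReal_norm ((starRingEnd ℂ) S), RCLike.norm_conj, ofReal_norm]
  have hdd : ‖∑' k, z k * (starRingEnd ℂ) (z k)‖ₑ = ∑' k, ‖z k‖ₑ ^ 2 := by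
    have h1 : (∑' k, z k * (starRingEnd ℂ) (z k)) = ((∑' k, ‖z k‖ ^ 2 : ℝ) : ℂ) := by
      rw [Complex.ofReal_tsum]
      exact tsum_congr fun k => by rw [Complex.mul_conj, Complex.normSq_eq_norm_sq]
    have h2 : Summable fun k => ‖z k‖ ^ 2 := by
      simpa [pow_two] using hd.norm
    rw [h1, ← ofReal_norm, Complex.norm_real,
      Real.norm_of_nonneg (tsum_nonneg fun _ => by positivity),
      ENNReal.ofReal_tsum_of_nonneg (fun _ => by positivity) h2]
    exact tsum_congr fun k => by rw [ENNReal.ofReal_pow (norm_nonneg _), ofReal_norm]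
  rw [← hSS, ← hdd]
  constructor
  · rw [hmain]
    exact (enorm_add_le _ _).trans (by gcongr)
  · rw [eq_sub_of_add_eq hmain.symm]
    exact enorm_sub_le.trans (by gcongr)

lemma aemeasurable_comp_add_const {u : ℝ → ℝ≥0∞} (hu : AEMeasurable u) (c : ℝ) :
    AEMeasurable fun ξ => u (ξ + c) :=
  hu.comp_quasiMeasurePreserving (measurePreserving_add_right volume c).quasiMeasurePreserving

/-- The pointwise expansion is applied to `z k = h (ξ + k * L)`; the diagonal and off-diagonal
series are themselves periodizations, so their integrals over a period unfold to integrals over `ℝ`.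
-/
lemma lintegral_periodization_offDiag {L : ℝ} (hL : 0 < L) {h : ℝ → ℂ} (hh : Integrable h) :
    ∫⁻ ξ in Ioc 0 L, ‖periodization L h ξ‖ₑ ^ 2 ≤ (∫⁻ ξ, ‖h ξ‖ₑ ^ 2) +
        ∫⁻ ξ, ∑' j : ({0}ᶜ : Set ℤ), ‖h ξ‖ₑ * ‖h (ξ + (j : ℤ) * L)‖ₑ ∧
      ∫⁻ ξ, ‖h ξ‖ₑ ^ 2 ≤ (∫⁻ ξ in Ioc 0 L, ‖periodization L h ξ‖ₑ ^ 2) +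
        ∫⁻ ξ, ∑' j : ({0}ᶜ : Set ℤ), ‖h ξ‖ₑ * ‖h (ξ + (j : ℤ) * L)‖ₑ := by
  have hm : AEMeasurable fun ξ => ‖h ξ‖ₑ := hh.aestronglyMeasurable.enorm
  have hm2 : AEMeasurable fun ξ => ‖h ξ‖ₑ ^ 2 := hm.pow_const 2
  have ho : AEMeasurable fun ξ => ∑' j : ({0}ᶜ : Set ℤ), ‖h ξ‖ₑ * ‖h (ξ + (j : ℤ) * L)‖ₑ :=
    .tsum fun j => hm.mul (aemeasurable_comp_add_const hm _)
  have hd : AEMeasurable fun ξ => ∑' k : ℤ, ‖h (ξ + k * L)‖ₑ ^ 2 :=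
    .tsum fun k => aemeasurable_comp_add_const hm2 _
  have hp : AEMeasurable fun ξ => ‖periodization L h ξ‖ₑ ^ 2 :=
    (aestronglyMeasurable_periodization L hh.aestronglyMeasurable).enorm.pow_const 2
  rw [lintegral_eq_lintegral_periodization hL hm2, lintegral_eq_lintegral_periodization hL ho,
    ← lintegral_add_left' hd.restrict, ← lintegral_add_left' hp.restrict]
  have key : ∀ᵐ ξ ∂(volume.restrict (Ioc 0 L)), _ :=
    (ae_summable_periodization hL hh).mono fun ξ hξ => tsum_enorm_sq_offDiag hξ
  have e (ξ : ℝ) (k j : ℤ) : ξ + k * L + j * L = ξ + (k + j : ℤ) * L := by push_cast; ring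
  simp only [e]
  exact ⟨lintegral_mono_ae (key.mono fun ξ h => h.1), lintegral_mono_ae (key.mono fun ξ h => h.2)⟩

lemma ennreal_two_mul_le_sq_add_sq (x y : ℝ≥0∞) : 2 * (x * y) ≤ x ^ 2 + y ^ 2 := by
  rw [two_mul]
  rcases le_total x y with h | h
  · obtain ⟨d, rfl⟩ := exists_add_of_le h
    calc _ ≤ x * (x + d) + x * (x + d) + d ^ 2 := le_self_add
      _ = _ := by ring
  · obtain ⟨d, rfl⟩ := exists_add_of_le h
    calc _ ≤ (y + d) * y + (y + d) * y + d ^ 2 := le_self_add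
      _ = _ := by ring

/-- A Schur-type estimate for the off-diagonal terms. -/
lemma lintegral_offDiag_le (L : ℝ) {φ T : ℝ → ℝ≥0∞} (hφ : AEMeasurable φ) (hT : AEMeasurable T) :
    ∫⁻ ξ, ∑' j : ({0}ᶜ : Set ℤ), (T ξ * φ ξ) * (T (ξ + (j : ℤ) * L) * φ (ξ + (j : ℤ) * L)) ≤
      ∫⁻ ξ, φ ξ ^ 2 * ∑' j : ({0}ᶜ : Set ℤ), T ξ * T (ξ + (j : ℤ) * L) := by
  have sh {u : ℝ → ℝ≥0∞} (hu : AEMeasurable u) (c : ℝ) := aemeasurable_comp_add_const hu c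
  have m1 (j : ℤ) : AEMeasurable fun ξ => φ ξ ^ 2 * (T ξ * T (ξ + j * L)) :=
    (hφ.pow_const 2).mul (hT.mul (sh hT _))
  set X := ∫⁻ ξ, φ ξ ^ 2 * ∑' j : ({0}ᶜ : Set ℤ), T ξ * T (ξ + (j : ℤ) * L) with hX
  have hX1 : ∑' j : ({0}ᶜ : Set ℤ), ∫⁻ ξ, φ ξ ^ 2 * (T ξ * T (ξ + (j : ℤ) * L)) = X := by
    rw [← lintegral_tsum fun j : ({0}ᶜ : Set ℤ) => m1 j, hX]
    simp only [ENNReal.tsum_mul_left]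
  have hX2 : ∑' j : ({0}ᶜ : Set ℤ),
      ∫⁻ ξ, φ (ξ + (j : ℤ) * L) ^ 2 * (T ξ * T (ξ + (j : ℤ) * L)) = X := by
    rw [← hX1]
    -- Replacing `j` by `-j` and translating by `j * L` exchanges the roles of `ξ` and `ξ + j * L`,
    -- so both weighted sums equal `X`.
    let ν : ({0}ᶜ : Set ℤ) ≃ ({0}ᶜ : Set ℤ) :=
      (Equiv.neg ℤ).subtypeEquiv fun j => by simp
    rw [← ν.tsum_eq]
    refine tsum_congr fun j => ?_
    rw [← (measurePreserving_add_right volume ((j : ℤ) * L)).lintegral_comp_emb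
      (measurableEmbedding_addRight _)]
    refine lintegral_congr fun ξ => ?_
    have : ((ν j : ℤ) : ℝ) = -(j : ℤ) := by simp [ν]
    rw [this, show ξ + (j : ℤ) * L + -(j : ℤ) * L = ξ by ring]
    ring
  have h2 : 2 * ∫⁻ ξ, ∑' j : ({0}ᶜ : Set ℤ),
      (T ξ * φ ξ) * (T (ξ + (j : ℤ) * L) * φ (ξ + (j : ℤ) * L)) ≤ 2 * X := by
    conv_rhs => rw [two_mul]; rw [← hX1]; arg 2; rw [hX1, ← hX2]
    have m3 (j : ({0}ᶜ : Set ℤ)) : AEMeasurable fun ξ =>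
        (T ξ * φ ξ) * (T (ξ + (j : ℤ) * L) * φ (ξ + (j : ℤ) * L)) :=
      (hT.mul hφ).mul ((sh hT _).mul (sh hφ _))
    rw [lintegral_tsum m3, ← ENNReal.tsum_mul_left,
      ← ENNReal.tsum_add]
    refine ENNReal.tsum_le_tsum fun j => ?_
    rw [← lintegral_const_mul' _ _ (by norm_num), ← lintegral_add_left' (m1 j)]
    refine lintegral_mono fun ξ => ?_
    calc _ = 2 * (φ ξ * φ (ξ + (j : ℤ) * L)) * (T ξ * T (ξ + (j : ℤ) * L)) := by ring
      _ ≤ (φ ξ ^ 2 + φ (ξ + (j : ℤ) * L) ^ 2) * (T ξ * T (ξ + (j : ℤ) * L)) := by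
        gcongr; exact ennreal_two_mul_le_sq_add_sq _ _
      _ = _ := by ring
  exact (ENNReal.mul_le_mul_iff_right (by norm_num) (by norm_num)).mp h2

lemma integrable_mul_conj (g f : L2) : Integrable fun ξ => g ξ * (starRingEnd ℂ) (f ξ) := by
  have := L2.integrable_inner (𝕜 := ℂ) f g
  simpa [RCLike.inner_apply, mul_comm] using this

lemma lintegral_enorm_sq_eq (f : L2) : ∫⁻ ξ, ‖f ξ‖ₑ ^ 2 = ENNReal.ofReal (‖f‖ ^ 2) := by
  rw [ENNReal.ofReal_pow (norm_nonneg _), ofReal_norm, Lp.enorm_def,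
    eLpNorm_eq_lintegral_rpow_enorm_toReal (by norm_num) (by norm_num)]
  simp only [ENNReal.toReal_ofNat, ENNReal.rpow_ofNat, one_div]
  rw [← ENNReal.rpow_natCast, ← ENNReal.rpow_mul]
  norm_num

/-- Two-sided estimate of the coefficients in a single channel. -/
lemma channel_bounds {a : ℝ} (ha : 0 < a) (f g : L2) {B R : ℝ≥0∞}
    (hB : ∀ᵐ ξ, (𝓕 f : L2) ξ ≠ 0 → ENNReal.ofReal (1 / a) * ‖g ξ‖ₑ ^ 2 ≤ B)
    (hR : ∀ᵐ ξ, (𝓕 f : L2) ξ ≠ 0 → ENNReal.ofReal (1 / a) *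
      ∑' j : ({0}ᶜ : Set ℤ), ‖g ξ‖ₑ * ‖g (ξ + (j : ℤ) * (1 / a))‖ₑ ≤ R)
    (hB' : B ≠ ∞) (hR' : R ≠ ∞) :
    ∑' n : ℤ, ‖inner ℂ f (translateL2 (n * a) (𝓕⁻ g))‖ₑ ^ 2 ≤
      (∫⁻ ξ, ‖(𝓕 f : L2) ξ‖ₑ ^ 2 * (ENNReal.ofReal (1 / a) * ‖g ξ‖ₑ ^ 2)) +
      (∫⁻ ξ, ‖(𝓕 f : L2) ξ‖ₑ ^ 2 * (ENNReal.ofReal (1 / a) *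
        ∑' j : ({0}ᶜ : Set ℤ), ‖g ξ‖ₑ * ‖g (ξ + (j : ℤ) * (1 / a))‖ₑ)) ∧
    (∫⁻ ξ, ‖(𝓕 f : L2) ξ‖ₑ ^ 2 * (ENNReal.ofReal (1 / a) * ‖g ξ‖ₑ ^ 2)) ≤
      ∑' n : ℤ, ‖inner ℂ f (translateL2 (n * a) (𝓕⁻ g))‖ₑ ^ 2 +
      (∫⁻ ξ, ‖(𝓕 f : L2) ξ‖ₑ ^ 2 * (ENNReal.ofReal (1 / a) *
        ∑' j : ({0}ᶜ : Set ℤ), ‖g ξ‖ₑ * ‖g (ξ + (j : ℤ) * (1 / a))‖ₑ)) := by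
  set L := 1 / a with hLdef
  have hL : 0 < L := by positivity
  have haL : a * L = 1 := mul_one_div_cancel ha.ne'
  set φ : L2 := 𝓕 f with hφ
  set h : ℝ → ℂ := fun ξ => g ξ * (starRingEnd ℂ) (φ ξ) with hh
  have hint : Integrable h := integrable_mul_conj g φ
  have hn (ξ : ℝ) : ‖h ξ‖ₑ = ‖g ξ‖ₑ * ‖φ ξ‖ₑ := by
    rw [hh, enorm_mul, ← ofReal_norm ((starRingEnd ℂ) _), RCLike.norm_conj, ofReal_norm]
  have hφm : AEMeasurable fun ξ => ‖φ ξ‖ₑ := (Lp.aestronglyMeasurable φ).enorm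
  have hgm : AEMeasurable fun ξ => ‖g ξ‖ₑ := (Lp.aestronglyMeasurable g).enorm
  have hfin : ∫⁻ ξ, ‖φ ξ‖ₑ ^ 2 ≠ ∞ := by rw [lintegral_enorm_sq_eq]; exact ENNReal.ofReal_ne_top
  have hweight {u : ℝ → ℝ≥0∞} {M : ℝ≥0∞} (hM : M ≠ ∞) (hu : ∀ᵐ ξ, φ ξ ≠ 0 → u ξ ≤ M) :
      ∫⁻ ξ, ‖φ ξ‖ₑ ^ 2 * u ξ ≠ ∞ := by
    refine ne_top_of_le_ne_top (ENNReal.mul_ne_top hfin hM) ?_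
    rw [← lintegral_mul_const' _ _ hM]
    refine lintegral_mono_ae (hu.mono fun ξ h => ?_)
    by_cases h0 : φ ξ = 0
    · simp [h0]
    · gcongr; exact h h0
  obtain ⟨b1, b2⟩ := lintegral_periodization_offDiag hL hint
  have hdiag : ENNReal.ofReal L * ∫⁻ ξ, ‖h ξ‖ₑ ^ 2 =
      ∫⁻ ξ, ‖φ ξ‖ₑ ^ 2 * (ENNReal.ofReal L * ‖g ξ‖ₑ ^ 2) := by
    rw [← lintegral_const_mul' _ _ ENNReal.ofReal_ne_top]
    refine lintegral_congr fun ξ => ?_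
    rw [hn]; ring
  have hoff : ENNReal.ofReal L *
      ∫⁻ ξ, ∑' j : ({0}ᶜ : Set ℤ), ‖h ξ‖ₑ * ‖h (ξ + (j : ℤ) * L)‖ₑ ≤
      ∫⁻ ξ, ‖φ ξ‖ₑ ^ 2 * (ENNReal.ofReal L *
        ∑' j : ({0}ᶜ : Set ℤ), ‖g ξ‖ₑ * ‖g (ξ + (j : ℤ) * L)‖ₑ) := by
    simp only [hn]
    refine (mul_le_mul_right (lintegral_offDiag_le L hφm hgm) _).trans_eq ?_
    rw [← lintegral_const_mul' _ _ ENNReal.ofReal_ne_top]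
    refine lintegral_congr fun ξ => ?_
    ring
  have hscale1 := mul_le_mul_right b1 (ENNReal.ofReal L)
  have hscale2 := mul_le_mul_right b2 (ENNReal.ofReal L)
  rw [mul_add, hdiag] at hscale1 hscale2
  -- Parseval needs a square-integrable periodization. This comes from the upper estimate already
  -- obtained, and is where finiteness of `B` and `R` enters.
  have hper : ∫⁻ ξ in Ioc 0 L, ‖periodization L h ξ‖ₑ ^ 2 ≠ ∞ := by
    have h1 := ne_top_of_le_ne_top (ENNReal.add_ne_top.mpr ⟨hweight hB' hB, hweight hR' hR⟩)
      (hscale1.trans (by gcongr))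
    intro h2
    rw [h2, ENNReal.mul_top (by simpa using hL)] at h1
    exact h1 rfl
  have hpars := tsum_enorm_sq_integral_modFactor hL haL hint hper
  have hcoef : ∑' n : ℤ, ‖inner ℂ f (translateL2 (n * a) (𝓕⁻ g))‖ₑ ^ 2 =
      ENNReal.ofReal L * ∫⁻ ξ in Ioc 0 L, ‖periodization L h ξ‖ₑ ^ 2 := by
    rw [← hpars]
    exact tsum_congr fun n => by rw [inner_translateL2_fourierInv]
  rw [hcoef]
  exact ⟨hscale1.trans (by gcongr), hscale2.trans (by gcongr)⟩

/-- Two-sided estimate of the coefficients of a filter bank: the diagonal part is controlled by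
`A` and `B`, the off-diagonal part by `R`. -/
theorem filterBank_bounds {D : Set ℝ} {a : ℤ → ℝ} (ha : ∀ m, 0 < a m) (g : ℤ → L2)
    {A B R : ℝ≥0∞} (hB' : B ≠ ∞) (hR' : R ≠ ∞)
    (hA : ∀ᵐ ξ, ξ ∈ D → A ≤ ∑' m, ENNReal.ofReal (1 / a m) * ‖g m ξ‖ₑ ^ 2)
    (hB : ∀ᵐ ξ, ξ ∈ D → ∑' m, ENNReal.ofReal (1 / a m) * ‖g m ξ‖ₑ ^ 2 ≤ B)
    (hR : ∀ᵐ ξ, ξ ∈ D → ∑' m, ENNReal.ofReal (1 / a m) *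
      ∑' j : ({0}ᶜ : Set ℤ), ‖g m ξ‖ₑ * ‖g m (ξ + (j : ℤ) * (1 / a m))‖ₑ ≤ R)
    {f : L2} (hf : f ∈ signalSpace D) :
    ∑' p, ‖inner ℂ f (filterBank g a p)‖ₑ ^ 2 ≤ (B + R) * ENNReal.ofReal (‖f‖ ^ 2) ∧
    A * ENNReal.ofReal (‖f‖ ^ 2) ≤
      ∑' p, ‖inner ℂ f (filterBank g a p)‖ₑ ^ 2 + R * ENNReal.ofReal (‖f‖ ^ 2) := by
  have hD : ∀ᵐ ξ, (𝓕 f : L2) ξ ≠ 0 → ξ ∈ D := by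
    have hf' : ∀ᵐ ξ : ℝ, ξ ∉ D → (𝓕 f : L2) ξ = 0 := hf
    exact hf'.mono fun ξ h h0 => by_contra fun h1 => h0 (h h1)
  have hN : ENNReal.ofReal (‖f‖ ^ 2) = ∫⁻ ξ, ‖(𝓕 f : L2) ξ‖ₑ ^ 2 := by
    rw [lintegral_enorm_sq_eq, Lp.norm_fourier_eq]
  have hch (m : ℤ) := channel_bounds (ha m) f (g m) (B := B) (R := R)
    (by filter_upwards [hD, hB] with ξ h1 h2 h3 using (ENNReal.le_tsum m).trans (h2 (h1 h3)))
    (by filter_upwards [hD, hR] with ξ h1 h2 h3 using (ENNReal.le_tsum m).trans (h2 (h1 h3)))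
    hB' hR'
  have hgm (m : ℤ) : AEMeasurable fun ξ => ‖g m ξ‖ₑ := (Lp.aestronglyMeasurable (g m)).enorm
  have hφm : AEMeasurable fun ξ => ‖(𝓕 f : L2) ξ‖ₑ := (Lp.aestronglyMeasurable (𝓕 f : L2)).enorm
  have hdm (m : ℤ) : AEMeasurable fun ξ => ENNReal.ofReal (1 / a m) * ‖g m ξ‖ₑ ^ 2 :=
    ((hgm m).pow_const 2).const_mul _
  have hom (m : ℤ) : AEMeasurable fun ξ => ENNReal.ofReal (1 / a m) *
      ∑' j : ({0}ᶜ : Set ℤ), ‖g m ξ‖ₑ * ‖g m (ξ + (j : ℤ) * (1 / a m))‖ₑ :=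
    (AEMeasurable.tsum fun j =>
      (hgm m).mul (aemeasurable_comp_add_const (hgm m) _)).const_mul _
  have swap {u : ℤ → ℝ → ℝ≥0∞} (hu : ∀ m, AEMeasurable (u m)) :
      ∑' m, ∫⁻ ξ, ‖(𝓕 f : L2) ξ‖ₑ ^ 2 * u m ξ =
        ∫⁻ ξ, ‖(𝓕 f : L2) ξ‖ₑ ^ 2 * ∑' m, u m ξ := by
    have hm (m : ℤ) : AEMeasurable fun ξ => ‖(𝓕 f : L2) ξ‖ₑ ^ 2 * u m ξ :=
      (hφm.pow_const 2).mul (hu m)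
    rw [← lintegral_tsum hm]
    simp only [ENNReal.tsum_mul_left]
  have upper {u : ℝ → ℝ≥0∞} {M : ℝ≥0∞} (hM : M ≠ ∞) (hu : ∀ᵐ ξ, ξ ∈ D → u ξ ≤ M) :
      ∫⁻ ξ, ‖(𝓕 f : L2) ξ‖ₑ ^ 2 * u ξ ≤ M * ENNReal.ofReal (‖f‖ ^ 2) := by
    rw [hN, ← lintegral_const_mul' _ _ hM]
    refine lintegral_mono_ae ?_
    filter_upwards [hu, hD] with ξ h1 h2
    rw [mul_comm]
    by_cases h0 : (𝓕 f : L2) ξ = 0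
    · simp [h0]
    · gcongr; exact h1 (h2 h0)
  have lower : A * ENNReal.ofReal (‖f‖ ^ 2) ≤
      ∫⁻ ξ, ‖(𝓕 f : L2) ξ‖ₑ ^ 2 * ∑' m, ENNReal.ofReal (1 / a m) * ‖g m ξ‖ₑ ^ 2 := by
    rw [hN, ← lintegral_const_mul'' _ (hφm.pow_const 2)]
    refine lintegral_mono_ae ?_
    filter_upwards [hA, hD] with ξ h1 h2
    rw [mul_comm]
    by_cases h0 : (𝓕 f : L2) ξ = 0
    · simp [h0]
    · gcongr; exact h1 (h2 h0)
  have hsum : ∑' p, ‖inner ℂ f (filterBank g a p)‖ₑ ^ 2 =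
      ∑' (m : ℤ) (n : ℤ), ‖inner ℂ f (translateL2 (n * a m) (𝓕⁻ (g m)))‖ₑ ^ 2 :=
    ENNReal.tsum_prod'
  rw [hsum]
  constructor
  · refine (ENNReal.tsum_le_tsum fun m => (hch m).1).trans ?_
    rw [ENNReal.tsum_add, swap hdm, swap hom, add_mul]
    exact add_le_add (upper hB' hB) (upper hR' hR)
  · rw [← swap hdm] at lower
    refine lower.trans ((ENNReal.tsum_le_tsum fun m => (hch m).2).trans ?_)
    rw [ENNReal.tsum_add, swap hom]
    gcongr
    exact upper hR' hR

/-! ### Geometry of warping functions -/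

namespace IsWarpingFunction

variable {D : Set ℝ} {F : ℝ → ℝ}

lemma isOpen (hF : IsWarpingFunction D F) : IsOpen D := by
  rcases hF.domain with rfl | rfl
  exacts [isOpen_univ, isOpen_Ioi]

lemma convex (hF : IsWarpingFunction D F) : Convex ℝ D := by
  rcases hF.domain with rfl | rfl
  exacts [convex_univ, convex_Ioi 0]

lemma warpInv_mem (hF : IsWarpingFunction D F) (t : ℝ) : warpInv D F t ∈ D :=
  hF.bijOn.surjOn.mapsTo_invFunOn (mem_univ t)

lemma apply_warpInv (hF : IsWarpingFunction D F) (t : ℝ) : F (warpInv D F t) = t :=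
  hF.bijOn.invOn_invFunOn.2 (mem_univ t)

lemma warpInv_apply (hF : IsWarpingFunction D F) {ξ : ℝ} (hξ : ξ ∈ D) :
    warpInv D F (F ξ) = ξ :=
  hF.bijOn.invOn_invFunOn.1 hξ

lemma strictMonoOn (hF : IsWarpingFunction D F) : StrictMonoOn F D :=
  strictMonoOn_of_deriv_pos hF.convex hF.contDiffOn.continuousOn fun t ht =>
    hF.deriv_pos t (interior_subset ht)

lemma monotone_warpInv (hF : IsWarpingFunction D F) : Monotone (warpInv D F) := fun s t hst => by
  rwa [← hF.strictMonoOn.le_iff_le (hF.warpInv_mem s) (hF.warpInv_mem t), hF.apply_warpInv,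
    hF.apply_warpInv]

lemma range_warpInv (hF : IsWarpingFunction D F) : range (warpInv D F) = D :=
  Subset.antisymm (range_subset_iff.mpr hF.warpInv_mem) fun ξ hξ => ⟨F ξ, hF.warpInv_apply hξ⟩

lemma continuous_warpInv (hF : IsWarpingFunction D F) : Continuous (warpInv D F) := by
  rw [continuous_iff_continuousAt]
  intro t
  refine continuousAt_of_monotoneOn_of_image_mem_nhds (hF.monotone_warpInv.monotoneOn univ)
    univ_mem ?_
  rw [image_univ, hF.range_warpInv]
  exact hF.isOpen.mem_nhds (hF.warpInv_mem t)

lemma hasDerivAt_warpInv (hF : IsWarpingFunction D F) (t : ℝ) :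
    HasDerivAt (warpInv D F) (warpWeight D F t) t := by
  have hd : HasDerivAt F (deriv F (warpInv D F t)) (warpInv D F t) :=
    ((hF.contDiffOn.contDiffAt (hF.isOpen.mem_nhds (hF.warpInv_mem t))).differentiableAt
      one_ne_zero).hasDerivAt
  rw [warpWeight, one_div]
  exact HasDerivAt.of_local_left_inverse hF.continuous_warpInv.continuousAt hd
    (hF.deriv_pos _ (hF.warpInv_mem t)).ne' (Eventually.of_forall hF.apply_warpInv)

/-- Moderateness in integrated form. -/
lemma abs_warpInv_add_sub_le (hF : IsWarpingFunction D F) {v : ℝ → ℝ} {C : ℝ}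
    (hv : IsModerateWith (warpWeight D F) v C) (y s t : ℝ) :
    |warpInv D F (t + y) - warpInv D F (s + y)| ≤
      C * v y * |warpInv D F t - warpInv D F s| := by
  wlog hst : s ≤ t generalizing s t
  · rw [abs_sub_comm, abs_sub_comm (warpInv D F t)]
    exact this t s (le_of_not_ge hst)
  -- The derivative of this difference is nonnegative precisely by moderateness.
  have hmono : Monotone fun u => C * v y * warpInv D F u - warpInv D F (u + y) := by
    refine monotone_of_hasDerivAt_nonneg
      (f' := fun u => C * v y * warpWeight D F u - warpWeight D F (u + y)) (fun u => ?_) fun u => ?_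
    · exact ((hF.hasDerivAt_warpInv u).const_mul _).sub
        ((hF.hasDerivAt_warpInv (u + y)).comp_add_const u y)
    · have := hv.le_mul y u
      rw [add_comm] at this
      exact sub_nonneg.mpr this
  have h := hmono hst
  simp only at h
  rw [abs_of_nonneg (sub_nonneg.mpr (hF.monotone_warpInv (by linarith))),
    abs_of_nonneg (sub_nonneg.mpr (hF.monotone_warpInv hst))]
  linarith

/-- Frequency spacing becomes spacing in the variable `warpInv D F (F ξ - y)`. With `y = m` the loss
`C * v m` is what the natural downsampling factors compensate. -/
lemma abs_sub_le (hF : IsWarpingFunction D F) {v : ℝ → ℝ} {C : ℝ}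
    (hv : IsModerateWith (warpWeight D F) v C) (y : ℝ) {ξ η : ℝ} (hξ : ξ ∈ D) (hη : η ∈ D) :
    |ξ - η| ≤ C * v y * |warpInv D F (F ξ - y) - warpInv D F (F η - y)| := by
  have := hF.abs_warpInv_add_sub_le hv y (F η - y) (F ξ - y)
  rwa [sub_add_cancel, sub_add_cancel, hF.warpInv_apply hξ, hF.warpInv_apply hη] at this

/-- Preimages of null sets under `ξ ↦ F ξ - c` are null sets. -/
lemma ae_comp_sub (hF : IsWarpingFunction D F) {P : ℝ → Prop} (hP : ∀ᵐ s, P s) (c : ℝ) :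
    ∀ᵐ ξ, ξ ∈ D → P (F ξ - c) := by
  -- The exceptional set is the image of a null set under a differentiable map, hence null.
  have h0 : volume ((fun s => warpInv D F (s + c)) '' {s | ¬ P s}) = 0 := by
    refine addHaar_image_eq_zero_of_differentiableOn_of_addHaar_eq_zero _ (fun s _ => ?_) hP
    exact ((hF.hasDerivAt_warpInv (s + c)).comp_add_const s c).differentiableAt
      |>.differentiableWithinAt
  refine measure_mono_null (fun ξ hξ => ?_) h0
  simp only [mem_compl_iff, mem_ofPred_eq, not_forall] at hξ
  obtain ⟨h1, h2⟩ := hξ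
  exact ⟨F ξ - c, h2, by simp [hF.warpInv_apply h1]⟩

lemma aestronglyMeasurable_comp_sub (hF : IsWarpingFunction D F) {θ : ℝ → ℂ}
    (hθ : AEStronglyMeasurable θ) (c : ℝ) :
    AEStronglyMeasurable (fun ξ => θ (F ξ - c)) (volume.restrict D) := by
  have hFm : AEMeasurable (fun ξ => F ξ - c) (volume.restrict D) :=
    (hF.contDiffOn.continuousOn.aemeasurable hF.isOpen.measurableSet).sub_const c
  refine (hθ.stronglyMeasurable_mk.measurable.comp_aemeasurable hFm).aestronglyMeasurable.congr ?_
  rw [EventuallyEq, ae_restrict_iff' hF.isOpen.measurableSet]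
  exact (hF.ae_comp_sub hθ.ae_eq_mk c).mono fun ξ h hξ => (h hξ).symm

end IsWarpingFunction

/-! ### Decay and separation -/

/-- The asymptotic bound holds off a compact set; on that set `θ` is essentially bounded and the
positive weight is bounded below. Used with `h` the identity and with `h` the inverse warping
function. -/
lemma exists_ae_decay {θ : ℝ → ℂ} {h : ℝ → ℝ} (hh : Continuous h) {p M : ℝ} (hp : 0 ≤ p)
    (hθ : θ =O[cocompact ℝ] fun t => (1 + |h t|) ^ (-p)) (hM : ∀ᵐ t, ‖θ t‖ ≤ M) :
    ∃ K : ℝ, 0 < K ∧ ∀ᵐ t, ‖θ t‖ ≤ K * (1 + |h t|) ^ (-p) := by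
  obtain ⟨c, hc, hO⟩ := hθ.exists_pos
  obtain ⟨S, hS, hSc⟩ := mem_cocompact.mp hO.bound
  have hcont : Continuous fun t => (1 + |h t|) ^ p :=
    (by fun_prop : Continuous fun t => 1 + |h t|).rpow_const fun t => .inr hp
  obtain ⟨N, hN⟩ := hS.exists_bound_of_continuousOn hcont.continuousOn
  refine ⟨max c (|M| * |N|), lt_max_of_lt_left hc, hM.mono fun t ht => ?_⟩
  have hpos : 0 < 1 + |h t| := by positivity
  have hr : 0 < (1 + |h t|) ^ (-p) := Real.rpow_pos_of_pos hpos _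
  by_cases hts : t ∈ S
  · have h1 : (1 + |h t|) ^ p ≤ |N| := (le_abs_self _).trans ((hN t hts).trans (le_abs_self N))
    have h2 : (1 + |h t|) ^ p * (1 + |h t|) ^ (-p) = 1 := by
      rw [← Real.rpow_add hpos, add_neg_cancel, Real.rpow_zero]
    calc ‖θ t‖ ≤ |M| := ht.trans (le_abs_self M)
      _ = |M| * ((1 + |h t|) ^ p * (1 + |h t|) ^ (-p)) := by rw [h2, mul_one]
      _ ≤ |M| * (|N| * (1 + |h t|) ^ (-p)) := by gcongr
      _ = |M| * |N| * (1 + |h t|) ^ (-p) := by ring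
      _ ≤ _ := by gcongr; exact le_max_right _ _
  · have h1 : ‖θ t‖ ≤ c * ‖(1 + |h t|) ^ (-p)‖ := hSc hts
    rw [Real.norm_of_nonneg hr.le] at h1
    exact h1.trans (by gcongr; exact le_max_left _ _)

/-- A bound for the sums of `(1 + |y|) ^ (-p)` over `1`-separated points. -/
noncomputable def sepSum (p : ℝ) : ℝ≥0∞ :=
  ∑' j : ℤ, ENNReal.ofReal (2 ^ p * (1 + |(j : ℝ)|) ^ (-p))

lemma sepSum_ne_top {p : ℝ} (hp : 1 < p) : sepSum p ≠ ∞ := by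
  have h1 : Summable fun n : ℕ => ((n + 1 : ℕ) : ℝ) ^ (-p) :=
    (summable_nat_add_iff 1).mpr (Real.summable_nat_rpow.mpr (by linarith))
  have h2 : Summable fun j : ℤ => 2 ^ p * (1 + |(j : ℝ)|) ^ (-p) := by
    refine Summable.mul_left _ (Summable.of_nat_of_neg (h1.congr fun n => ?_)
      (h1.congr fun n => ?_)) <;> simp [add_comm]
  exact h2.tsum_ofReal_ne_top

/-- Separated points have distinct integer parts, and `1 + |⌊y⌋| ≤ 2 (1 + |y|)` accounts for the
factor `2 ^ p` in `sepSum`. -/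
lemma tsum_le_sepSum {ι : Type*} {p : ℝ} (hp : 0 ≤ p) {y : ι → ℝ}
    (hy : ∀ i j, i ≠ j → 1 ≤ |y i - y j|) :
    ∑' i, ENNReal.ofReal ((1 + |y i|) ^ (-p)) ≤ sepSum p := by
  have hinj : Function.Injective fun i => ⌊y i⌋ := fun i j hij => by
    by_contra hne
    exact (hy i j hne).not_gt (Int.abs_sub_lt_one_of_floor_eq_floor hij)
  refine le_trans (ENNReal.tsum_le_tsum fun i => ?_) (ENNReal.tsum_comp_le_tsum_of_injective hinj
    fun j : ℤ => ENNReal.ofReal (2 ^ p * (1 + |(j : ℝ)|) ^ (-p)))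
  refine ENNReal.ofReal_le_ofReal ?_
  have h1 : (1 + |(⌊y i⌋ : ℝ)|) / 2 ≤ 1 + |y i| := by
    have h2 : |(⌊y i⌋ : ℝ)| ≤ |y i| + 1 := by
      rw [abs_le]
      constructor
      · linarith [Int.lt_floor_add_one (y i), neg_abs_le (y i)]
      · linarith [Int.floor_le (y i), le_abs_self (y i)]
    linarith [abs_nonneg (y i)]
  refine (Real.rpow_le_rpow_of_nonpos (by positivity) h1 (by linarith)).trans_eq ?_
  rw [Real.div_rpow (by positivity) (by norm_num), Real.rpow_neg (by norm_num : (0 : ℝ) ≤ 2),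
    div_inv_eq_mul, mul_comm]

lemma tsum_le_sepSum_scaled {ι : Type*} {p b : ℝ} (hp : 0 ≤ p) (hb : 0 < b) {x : ι → ℝ}
    (hx : ∀ i j, i ≠ j → 1 / b ≤ |x i - x j|) :
    ∑' i, ENNReal.ofReal ((1 + |x i|) ^ (-p)) ≤ ENNReal.ofReal (max 1 b ^ p) * sepSum p := by
  have hy : ∀ i j, i ≠ j → 1 ≤ |b * x i - b * x j| := fun i j hij => by
    rw [← mul_sub, abs_mul, abs_of_pos hb]
    have := hx i j hij
    rwa [div_le_iff₀' hb] at this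
  refine le_trans ?_ (mul_le_mul_right (tsum_le_sepSum hp hy) _)
  rw [← ENNReal.tsum_mul_left]
  refine ENNReal.tsum_le_tsum fun i => ?_
  rw [← ENNReal.ofReal_mul (by positivity)]
  refine ENNReal.ofReal_le_ofReal ?_
  have hm : 0 < max 1 b := by positivity
  have h1 : (1 + |b * x i|) / max 1 b ≤ 1 + |x i| := by
    rw [div_le_iff₀ hm, abs_mul, abs_of_pos hb]
    nlinarith [le_max_left 1 b, le_max_right 1 b, abs_nonneg (x i)]
  refine (Real.rpow_le_rpow_of_nonpos (by positivity) h1 (by linarith)).trans_eq ?_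
  rw [Real.div_rpow (by positivity) hm.le, Real.rpow_neg hm.le, div_inv_eq_mul, mul_comm]

/-- The better of the two bounds is the one with `max a b`; its exponent can then be split, with `ε
/ 2` charged to `b` and the rest to `a`. -/
lemma le_rpow_mul_rpow {z K ε a b : ℝ} (hK : 0 ≤ K) (hε : 0 < ε) (ha : 1 ≤ a) (hb : 1 ≤ b)
    (h1 : z ≤ K * a ^ (-(1 + ε))) (h2 : z ≤ K * b ^ (-(1 + ε))) :
    z ≤ K * (a ^ (-(1 + ε / 2)) * b ^ (-(ε / 2))) := by
  have key : z ≤ K * max a b ^ (-(1 + ε)) := by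
    rcases max_choice a b with h | h <;> rw [h] <;> assumption
  refine key.trans (mul_le_mul_of_nonneg_left ?_ hK)
  have hm : 0 < max a b := by positivity
  rw [show -(1 + ε) = -(1 + ε / 2) + -(ε / 2) by ring, Real.rpow_add hm]
  have e1 := Real.rpow_le_rpow_of_nonpos (z := -(1 + ε / 2)) (by linarith : 0 < a)
    (le_max_left a b) (by linarith)
  have e2 := Real.rpow_le_rpow_of_nonpos (z := -(ε / 2)) (by linarith : 0 < b)
    (le_max_right a b) (by linarith)
  exact mul_le_mul e1 e2 (by positivity) (by positivity)

/-- The product estimate behind the smallness of the off-diagonal part. -/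
lemma decay_mul_decay_le {z z' K ε b s x x' : ℝ} (hz' : 0 ≤ z') (hK : 0 ≤ K)
    (hε : 0 < ε) (hb : 0 < b)
    (h1 : z ≤ K * (1 + |s|) ^ (-(1 + ε))) (h2 : z ≤ K * (1 + |x|) ^ (-(1 + ε)))
    (h3 : z' ≤ K * (1 + |x'|) ^ (-(1 + ε))) (hxx : 1 / b ≤ |x - x'|) :
    z * z' ≤ K ^ 2 * b ^ (ε / 2) *
      ((1 + |s|) ^ (-(1 + ε / 2)) * (1 + |x'|) ^ (-(1 + ε / 2))) := by
  have ps : 1 ≤ 1 + |s| := by linarith [abs_nonneg s]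
  have px : 1 ≤ 1 + |x| := by linarith [abs_nonneg x]
  have px' : 1 ≤ 1 + |x'| := by linarith [abs_nonneg x']
  have e1 := le_rpow_mul_rpow hK hε ps px h1 h2
  have e2 := le_rpow_mul_rpow hK hε px' px' h3 h3
  -- Two points at distance at least `1 / b` cannot both be near zero: `(1 + |x|) (1 + |x'|) ≥ |x -
  -- x'|`.
  have e3 : (1 + |x|) ^ (-(ε / 2)) * (1 + |x'|) ^ (-(ε / 2)) ≤ b ^ (ε / 2) := by
    rw [← Real.mul_rpow (by positivity) (by positivity)]
    have : 1 / b ≤ (1 + |x|) * (1 + |x'|) := by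
      have := abs_sub x x'
      nlinarith [abs_nonneg x, abs_nonneg x', mul_nonneg (abs_nonneg x) (abs_nonneg x')]
    refine (Real.rpow_le_rpow_of_nonpos (by positivity) this (by linarith)).trans_eq ?_
    rw [one_div, Real.inv_rpow hb.le, Real.rpow_neg hb.le, inv_inv]
  calc z * z' ≤ _ := mul_le_mul e1 e2 hz' (by positivity)
    _ = K ^ 2 * ((1 + |x|) ^ (-(ε / 2)) * (1 + |x'|) ^ (-(ε / 2))) *
        ((1 + |s|) ^ (-(1 + ε / 2)) * (1 + |x'|) ^ (-(1 + ε / 2))) := by ring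
    _ ≤ _ := by gcongr

/-! ### Warped filter banks -/

lemma naturalFactors_pos {w v : ℝ → ℝ} {C : ℝ} (hv : IsModerateWith w v C) {b : ℝ} (hb : 0 < b)
    (m : ℤ) : 0 < naturalFactors v C b m :=
  div_pos hb (mul_pos hv.const_pos (hv.weight.pos _))

lemma norm_warpedResponse_of_mem {D : Set ℝ} {F : ℝ → ℝ} {θ : ℝ → ℂ} {a : ℤ → ℝ} {m : ℤ} {ξ : ℝ}
    (hξ : ξ ∈ D) : ‖warpedResponse D F θ a m ξ‖ = √(a m) * ‖θ (F ξ - m)‖ := by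
  rw [warpedResponse, indicator_of_mem hξ, norm_mul, Complex.norm_real,
    Real.norm_of_nonneg (Real.sqrt_nonneg _)]

lemma enorm_warpedResponse_sq {D : Set ℝ} {F : ℝ → ℝ} {θ : ℝ → ℂ} {a : ℤ → ℝ} {m : ℤ} {ξ : ℝ}
    (ha : 0 < a m) (hξ : ξ ∈ D) :
    ENNReal.ofReal (1 / a m) * ‖warpedResponse D F θ a m ξ‖ₑ ^ 2 = ‖θ (F ξ - m)‖ₑ ^ 2 := by
  simp only [← ofReal_norm]
  rw [norm_warpedResponse_of_mem hξ, ← ENNReal.ofReal_pow (by positivity),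
    ← ENNReal.ofReal_pow (by positivity), ← ENNReal.ofReal_mul (by positivity), mul_pow,
    Real.sq_sqrt ha.le, ← mul_assoc, one_div_mul_cancel ha.ne', one_mul]

/-- The joint decay of the prototype `θ` at the point `s`. -/
def DecayAt (D : Set ℝ) (F : ℝ → ℝ) (θ : ℝ → ℂ) (K ε s : ℝ) : Prop :=
  ‖θ s‖ ≤ K * (1 + |s|) ^ (-(1 + ε)) ∧ ‖θ s‖ ≤ K * (1 + |warpInv D F s|) ^ (-(1 + ε))

variable {D : Set ℝ} {F : ℝ → ℝ} {θ : ℝ → ℂ} {K ε : ℝ} {v : ℝ → ℝ} {C : ℝ}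

lemma memLp_two_one_add_abs_rpow {p : ℝ} (hp : 1 < p) :
    MemLp (fun ξ : ℝ => (1 + |ξ|) ^ (-p)) 2 volume := by
  rw [memLp_two_iff_integrable_sq
    ((by fun_prop : Measurable fun ξ : ℝ => (1 + |ξ|) ^ (-p)).aestronglyMeasurable)]
  refine (integrable_one_add_norm (E := ℝ) (r := 2 * p) (by simp; linarith)).congr
    (Eventually.of_forall fun ξ => ?_)
  simp only [Real.norm_eq_abs]
  rw [← Real.rpow_natCast, ← Real.rpow_mul (by positivity)]
  congr 1
  push_cast
  ring

/-- Comparing `ξ` with `G m` through `abs_sub_le` gives `1 + |ξ| ≤ M (1 + |G (F ξ - m)|)`, so decay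
of `θ` in the variable `G` becomes decay of the response in `ξ`. -/
lemma memLp_warpedResponse (hF : IsWarpingFunction D F) (hθ : AEStronglyMeasurable θ)
    (hK : 0 ≤ K) (hε : 0 < ε) (hdec : ∀ᵐ s, DecayAt D F θ K ε s)
    (hv : IsModerateWith (warpWeight D F) v C) (a : ℤ → ℝ) (m : ℤ) :
    MemLp (warpedResponse D F θ a m) 2 volume := by
  have hmeas : AEStronglyMeasurable (warpedResponse D F θ a m) :=
    (aestronglyMeasurable_indicator_iff hF.isOpen.measurableSet).mpr
      ((hF.aestronglyMeasurable_comp_sub hθ m).const_mul _)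
  set G := warpInv D F
  set c := C * v m with hc
  have hc0 : 0 < c := mul_pos hv.const_pos (hv.weight.pos _)
  set M := 1 + |G m| + c * (1 + |G 0|) with hM
  have hM0 : 0 < M := by positivity
  refine (memLp_two_one_add_abs_rpow (p := 1 + ε) (by linarith)).of_le_mul
    (c := √(a m) * K * M ^ (1 + ε)) hmeas ?_
  filter_upwards [hF.ae_comp_sub hdec m] with ξ hξ
  by_cases hD : ξ ∈ D
  · have h1 : (1 + |ξ|) / M ≤ 1 + |G (F ξ - m)| := by
      have h2 := hF.abs_sub_le hv m hD (hF.warpInv_mem m)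
      rw [hF.apply_warpInv, sub_self] at h2
      have h3 : |G (F ξ - m) - G 0| ≤ |G (F ξ - m)| + |G 0| := abs_sub _ _
      have h4 : |ξ| ≤ |ξ - G m| + |G m| := by
        simpa using abs_add_le (ξ - G m) (G m)
      have h5 : |ξ - G m| ≤ c * (|G (F ξ - m)| + |G 0|) :=
        h2.trans (mul_le_mul_of_nonneg_left h3 hc0.le)
      rw [div_le_iff₀ hM0]
      nlinarith [abs_nonneg (G (F ξ - m)), abs_nonneg (G m), abs_nonneg (G 0),
        mul_nonneg (abs_nonneg (G (F ξ - m))) (abs_nonneg (G m)),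
        mul_nonneg hc0.le (mul_nonneg (abs_nonneg (G (F ξ - m))) (abs_nonneg (G 0)))]
    have h2 : (1 + |G (F ξ - m)|) ^ (-(1 + ε)) ≤ M ^ (1 + ε) * (1 + |ξ|) ^ (-(1 + ε)) := by
      refine (Real.rpow_le_rpow_of_nonpos (by positivity) h1 (by linarith)).trans_eq ?_
      rw [Real.div_rpow (by positivity) hM0.le, Real.rpow_neg hM0.le, div_inv_eq_mul, mul_comm]
    rw [norm_warpedResponse_of_mem hD, Real.norm_of_nonneg (by positivity)]
    calc _ ≤ √(a m) * (K * (M ^ (1 + ε) * (1 + |ξ|) ^ (-(1 + ε)))) := by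
          gcongr
          exact (hξ hD).2.trans (by gcongr)
      _ = _ := by ring
  · rw [warpedResponse, indicator_of_notMem hD, norm_zero]
    positivity

/-- The off-diagonal sum of a single channel. -/
lemma offDiag_channel_le (hF : IsWarpingFunction D F) (hK : 0 ≤ K) (hε : 0 < ε)
    (hv : IsModerateWith (warpWeight D F) v C) {b : ℝ} (hb : 0 < b) (m : ℤ) {ξ : ℝ} (hξ : ξ ∈ D)
    (hdec : ∀ j : ℤ, ξ + j * (1 / naturalFactors v C b m) ∈ D →
      DecayAt D F θ K ε (F (ξ + j * (1 / naturalFactors v C b m)) - m)) :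
    ENNReal.ofReal (1 / naturalFactors v C b m) * ∑' j : ({0}ᶜ : Set ℤ),
        ‖warpedResponse D F θ (naturalFactors v C b) m ξ‖ₑ *
          ‖warpedResponse D F θ (naturalFactors v C b) m
            (ξ + (j : ℤ) * (1 / naturalFactors v C b m))‖ₑ ≤
      ENNReal.ofReal (K ^ 2 * b ^ (ε / 2)) * (ENNReal.ofReal (max 1 b ^ (1 + ε / 2)) *
        sepSum (1 + ε / 2)) * ENNReal.ofReal ((1 + |F ξ - m|) ^ (-(1 + ε / 2))) := by
  set a := naturalFactors v C b with ha
  have ha0 : 0 < a m := naturalFactors_pos hv hb m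
  have hc0 : 0 < C * v m := mul_pos hv.const_pos (hv.weight.pos _)
  set p := 1 + ε / 2 with hp
  set W := warpedResponse D F θ a m with hW
  set η : ℤ → ℝ := fun j => ξ + j * (1 / a m) with hη
  set x : ℤ → ℝ := fun j => warpInv D F (F (η j) - m) with hx
  have hη0 : η 0 = ξ := by simp [hη]
  -- Shifts differ by a nonzero multiple of `C * v m / b`, and `C * v m` cancels against the
  -- moderateness constant.
  have hsep (i j : ℤ) (hi : η i ∈ D) (hj : η j ∈ D) (hij : i ≠ j) : 1 / b ≤ |x i - x j| := by
    have h1 := hF.abs_sub_le hv m hi hj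
    have h2 : η i - η j = (i - j : ℤ) * (C * v m / b) := by
      simp only [hη, ha, naturalFactors, one_div_div]
      push_cast
      ring
    have h3 : (1 : ℝ) ≤ |((i - j : ℤ) : ℝ)| := by
      exact_mod_cast Int.one_le_abs (sub_ne_zero.mpr hij)
    rw [h2, abs_mul, abs_of_pos (div_pos hc0 hb)] at h1
    have h4 : C * v m / b ≤ C * v m * |x i - x j| :=
      (le_mul_of_one_le_left (by positivity) h3).trans h1
    rw [div_eq_mul_one_div] at h4
    exact le_of_mul_le_mul_left h4 hc0
  -- Only shifts landing in `D` contribute; separation is available only for these.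
  set I : Set ({0}ᶜ : Set ℤ) := {j | η j ∈ D} with hI
  have hterm (j : ({0}ᶜ : Set ℤ)) : ENNReal.ofReal (1 / a m) * (‖W ξ‖ₑ * ‖W (η j)‖ₑ) ≤
      ENNReal.ofReal (K ^ 2 * b ^ (ε / 2)) * ENNReal.ofReal ((1 + |F ξ - m|) ^ (-p)) *
        I.indicator (fun j => ENNReal.ofReal ((1 + |x j|) ^ (-p))) j := by
    by_cases hj : η j ∈ D
    · have h0 : η 0 ∈ D := hη0 ▸ hξ
      have hs := hsep 0 j h0 hj (fun h => j.2 h.symm)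
      have hd0 := hdec 0 h0
      have hdj := hdec j hj
      have hx0 : x 0 = warpInv D F (F ξ - m) := by simp only [hx, hη0]
      rw [show ξ + ((0 : ℤ) : ℝ) * (1 / a m) = ξ from hη0] at hd0
      rw [hx0] at hs
      have hmul := decay_mul_decay_le (norm_nonneg _) hK hε hb hd0.1 hd0.2 hdj.2 hs
      rw [indicator_of_mem (show j ∈ I from hj), mul_assoc (ENNReal.ofReal _),
        ← ENNReal.ofReal_mul (by positivity), ← ENNReal.ofReal_mul (by positivity),
        ← ofReal_norm, ← ofReal_norm, ← ENNReal.ofReal_mul (by positivity),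
        ← ENNReal.ofReal_mul (by positivity)]
      refine ENNReal.ofReal_le_ofReal (le_trans (le_of_eq ?_) hmul)
      rw [hW, norm_warpedResponse_of_mem hξ, norm_warpedResponse_of_mem hj]
      have h1 : √(a m) * √(a m) = a m := Real.mul_self_sqrt ha0.le
      have h2 : 1 / a m * a m = 1 := one_div_mul_cancel ha0.ne'
      linear_combination (1 / a m * ‖θ (F ξ - m)‖ * ‖θ (F (η j) - m)‖) * h1 +
        ‖θ (F ξ - m)‖ * ‖θ (F (η j) - m)‖ * h2
    · have : W (η j) = 0 := indicator_of_notMem hj _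
      simp [this]
  rw [← ENNReal.tsum_mul_left]
  refine (ENNReal.tsum_le_tsum hterm).trans ?_
  rw [ENNReal.tsum_mul_left, ← tsum_subtype]
  have hsum : ∑' j : I, ENNReal.ofReal ((1 + |x j|) ^ (-p)) ≤
      ENNReal.ofReal (max 1 b ^ p) * sepSum p :=
    tsum_le_sepSum_scaled (by positivity) hb fun i j hij =>
      hsep _ _ i.2 j.2 fun h => hij (Subtype.ext (Subtype.ext h))
  refine (mul_le_mul_right hsum _).trans_eq ?_
  ring

/-- The bound for the off-diagonal part of the warped filter bank. -/
noncomputable def offDiagBound (K ε b : ℝ) : ℝ≥0∞ :=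
  ENNReal.ofReal (K ^ 2 * b ^ (ε / 2)) * (ENNReal.ofReal (max 1 b ^ (1 + ε / 2)) *
    sepSum (1 + ε / 2)) * sepSum (1 + ε / 2)

lemma offDiagBound_ne_top (K : ℝ) {ε : ℝ} (hε : 0 < ε) (b : ℝ) : offDiagBound K ε b ≠ ∞ := by
  have h := sepSum_ne_top (p := 1 + ε / 2) (by linarith)
  exact ENNReal.mul_ne_top (ENNReal.mul_ne_top ENNReal.ofReal_ne_top
    (ENNReal.mul_ne_top ENNReal.ofReal_ne_top h)) h

/-- For `b ≤ 1` the factor `max 1 b` is `1`, so only `b ^ (ε / 2)` depends on `b`, and it tends to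
zero. -/
lemma exists_offDiagBound_le (K : ℝ) {ε : ℝ} (hε : 0 < ε) {A : ℝ} (hA : 0 < A) :
    ∃ b₀ : ℝ, 0 < b₀ ∧ ∀ b, 0 < b → b ≤ b₀ → offDiagBound K ε b ≤ ENNReal.ofReal A := by
  set S := (sepSum (1 + ε / 2)).toReal with hS
  have hSe : sepSum (1 + ε / 2) = ENNReal.ofReal S :=
    (ENNReal.ofReal_toReal (sepSum_ne_top (by linarith))).symm
  have hS0 : 0 ≤ S := ENNReal.toReal_nonneg
  -- The `+ 1` keeps the denominator positive; `δ ^ (2 / ε)` inverts `b ↦ b ^ (ε / 2)`.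
  set δ := A / (K ^ 2 * S ^ 2 + 1) with hδ
  have hδ0 : 0 < δ := by positivity
  refine ⟨min 1 (δ ^ (2 / ε)), by positivity, fun b hb hbb => ?_⟩
  have h1 : max 1 b = 1 := max_eq_left (hbb.trans (min_le_left _ _))
  have h2 : b ^ (ε / 2) ≤ δ := by
    refine (Real.rpow_le_rpow hb.le (hbb.trans (min_le_right _ _)) (by positivity)).trans_eq ?_
    rw [← Real.rpow_mul hδ0.le, div_mul_div_comm, mul_comm 2 ε, div_self (by positivity),
      Real.rpow_one]
  rw [offDiagBound, h1, Real.one_rpow, ENNReal.ofReal_one, one_mul, hSe,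
    ← ENNReal.ofReal_mul (by positivity), ← ENNReal.ofReal_mul (by positivity)]
  refine ENNReal.ofReal_le_ofReal ?_
  calc K ^ 2 * b ^ (ε / 2) * S * S = K ^ 2 * S ^ 2 * b ^ (ε / 2) := by ring
    _ ≤ (K ^ 2 * S ^ 2 + 1) * δ := by gcongr; linarith
    _ = A := by rw [hδ]; field_simp

/-- Neither bound involves `v` or `C`, which is why one threshold for `b` serves all of them. -/
lemma warpedFilterBank_bounds (hF : IsWarpingFunction D F) (hK : 0 ≤ K) (hε : 0 < ε)
    (hdec : ∀ᵐ s, DecayAt D F θ K ε s) {A B : ℝ}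
    (hsum : ∀ᵐ t : ℝ, ENNReal.ofReal A ≤ ∑' m : ℤ, ‖θ (t - m)‖ₑ ^ 2 ∧
      ∑' m : ℤ, ‖θ (t - m)‖ₑ ^ 2 ≤ ENNReal.ofReal B)
    (hv : IsModerateWith (warpWeight D F) v C) {b : ℝ} (hb : 0 < b)
    (h : ∀ m, MemLp (warpedResponse D F θ (naturalFactors v C b) m) 2 volume) {f : L2}
    (hf : f ∈ signalSpace D) :
    ∑' p, ‖inner ℂ f (warpedFilterBank D F θ (naturalFactors v C b) h p)‖ₑ ^ 2 ≤
      (ENNReal.ofReal B + offDiagBound K ε b) * ENNReal.ofReal (‖f‖ ^ 2) ∧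
    ENNReal.ofReal A * ENNReal.ofReal (‖f‖ ^ 2) ≤
      ∑' p, ‖inner ℂ f (warpedFilterBank D F θ (naturalFactors v C b) h p)‖ₑ ^ 2 +
        offDiagBound K ε b * ENNReal.ofReal (‖f‖ ^ 2) := by
  set a := naturalFactors v C b with ha
  have ha0 (m : ℤ) : 0 < a m := naturalFactors_pos hv hb m
  have hsum' : ∀ᵐ ξ, ξ ∈ D → ENNReal.ofReal A ≤ ∑' m : ℤ, ‖θ (F ξ - m)‖ₑ ^ 2 ∧
      ∑' m : ℤ, ‖θ (F ξ - m)‖ₑ ^ 2 ≤ ENNReal.ofReal B := by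
    simpa only [sub_zero] using hF.ae_comp_sub hsum 0
  have hcoe : ∀ᵐ ξ, ∀ m, (h m).toLp _ ξ = warpedResponse D F θ a m ξ :=
    ae_all_iff.mpr fun m => (h m).coeFn_toLp
  have hdiag : ∀ᵐ ξ, ξ ∈ D → ∑' m, ENNReal.ofReal (1 / a m) * ‖(h m).toLp _ ξ‖ₑ ^ 2 =
      ∑' m : ℤ, ‖θ (F ξ - m)‖ₑ ^ 2 := by
    filter_upwards [hcoe] with ξ h1 h2
    exact tsum_congr fun m => by rw [h1 m, enorm_warpedResponse_sq (ha0 m) h2]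
  -- The cross terms evaluate the responses at countably many translates, so almost-everywhere facts
  -- must hold at all of them at once.
  have hshift {P : ℤ → ℝ → Prop} (hP : ∀ m, ∀ᵐ ξ, P m ξ) :
      ∀ᵐ ξ, ∀ (m j : ℤ), P m (ξ + j * (1 / a m)) :=
    ae_all_iff.mpr fun m => ae_all_iff.mpr fun j =>
      (measurePreserving_add_right volume ((j : ℝ) * (1 / a m))).quasiMeasurePreserving.ae (hP m)
  refine filterBank_bounds (D := D) ha0 (fun m => (h m).toLp _) ENNReal.ofReal_ne_top
    (offDiagBound_ne_top K hε b) ?_ ?_ ?_ hf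
  · filter_upwards [hdiag, hsum'] with ξ h1 h2 h3
    rw [h1 h3]; exact (h2 h3).1
  · filter_upwards [hdiag, hsum'] with ξ h1 h2 h3
    rw [h1 h3]; exact (h2 h3).2
  · filter_upwards [hcoe, hshift fun m => (h m).coeFn_toLp,
      hshift fun m => hF.ae_comp_sub hdec m] with ξ h1 h2 h3 hξ
    calc _ = ∑' m : ℤ, ENNReal.ofReal (1 / a m) * ∑' j : ({0}ᶜ : Set ℤ),
          ‖warpedResponse D F θ a m ξ‖ₑ *
            ‖warpedResponse D F θ a m (ξ + (j : ℤ) * (1 / a m))‖ₑ := by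
          simp only [h1, h2]
      _ ≤ ∑' m : ℤ, ENNReal.ofReal (K ^ 2 * b ^ (ε / 2)) *
          (ENNReal.ofReal (max 1 b ^ (1 + ε / 2)) * sepSum (1 + ε / 2)) *
          ENNReal.ofReal ((1 + |F ξ - m|) ^ (-(1 + ε / 2))) :=
        ENNReal.tsum_le_tsum fun m => offDiag_channel_le hF hK hε hv hb m hξ (h3 m)
      _ ≤ offDiagBound K ε b := by
        rw [ENNReal.tsum_mul_left, offDiagBound]
        gcongr
        refine tsum_le_sepSum (by positivity) fun i j hij => ?_
        rw [sub_sub_sub_cancel_left, abs_sub_comm]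
        exact_mod_cast Int.one_le_abs (sub_ne_zero.mpr hij)

lemma warpedFilterBank_mem_signalSpace {a : ℤ → ℝ}
    (h : ∀ m, MemLp (warpedResponse D F θ a m) 2 volume) (p : ℤ × ℤ) :
    warpedFilterBank D F θ a h p ∈ signalSpace D := by
  refine translateL2_fourierInv_mem_signalSpace _ ?_
  filter_upwards [(h p.1).coeFn_toLp] with ξ h1 h2
  rw [h1, warpedResponse, indicator_of_notMem h2]

/-- The `m = 0` term of the sum bounds `‖θ‖` by `√B` almost everywhere, which covers the compact set
on which the asymptotic conditions say nothing. -/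
lemma exists_decayAt (hF : IsWarpingFunction D F) (hε : 0 < ε)
    (hθ₁ : θ =O[cocompact ℝ] fun t : ℝ => (1 + |t|) ^ (-1 - ε))
    (hθ₂ : θ =O[cocompact ℝ] fun t : ℝ => (1 + |warpInv D F t|) ^ (-1 - ε)) {B : ℝ}
    (hB : ∀ᵐ t : ℝ, ∑' m : ℤ, ‖θ (t - m)‖ₑ ^ 2 ≤ ENNReal.ofReal B) :
    ∃ K : ℝ, 0 < K ∧ ∀ᵐ s, DecayAt D F θ K ε s := by
  have hM : ∀ᵐ t, ‖θ t‖ ≤ √B := by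
    filter_upwards [hB] with t ht
    have h1 : ‖θ t‖ₑ ^ 2 ≤ ENNReal.ofReal B := by
      simpa using (ENNReal.le_tsum (f := fun m : ℤ => ‖θ (t - m)‖ₑ ^ 2) 0).trans ht
    rw [← ofReal_norm, ← ENNReal.ofReal_pow (norm_nonneg _)] at h1
    rcases le_or_gt (‖θ t‖) 0 with h0 | h0
    · exact h0.trans (Real.sqrt_nonneg _)
    · exact Real.le_sqrt_of_sq_le ((ENNReal.ofReal_le_ofReal_iff'.mp h1).resolve_right
        (not_le.mpr (by positivity)))
  have he : -1 - ε = -(1 + ε) := by ring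
  rw [he] at hθ₁ hθ₂
  obtain ⟨K₁, hK₁, h₁⟩ := exists_ae_decay continuous_id (by positivity) hθ₁ hM
  obtain ⟨K₂, -, h₂⟩ := exists_ae_decay hF.continuous_warpInv (by positivity) hθ₂ hM
  refine ⟨max K₁ K₂, lt_max_of_lt_left hK₁, ?_⟩
  filter_upwards [h₁, h₂] with s h₁ h₂
  exact ⟨h₁.trans (mul_le_mul_of_nonneg_right (le_max_left _ _) (by positivity)),
    h₂.trans (mul_le_mul_of_nonneg_right (le_max_right _ _) (by positivity))⟩

end WarpedFilterBank

/-! ### The Bessel and frame bounds -/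

open WarpedFilterBank in
theorem mainTheorem1 (D : Set ℝ) (F : ℝ → ℝ)
    (hF : WarpedFilterBank.IsWarpingFunction D F)
    (θ : ℝ → ℂ) (hθ : AEStronglyMeasurable θ (volume : Measure ℝ))
    (ε : ℝ) (hε : 0 < ε)
    (hθ₁ : θ =O[cocompact ℝ] fun t : ℝ => (1 + |t|) ^ (-1 - ε))
    (hθ₂ : θ =O[cocompact ℝ] fun t : ℝ =>
      (1 + |WarpedFilterBank.warpInv D F t|) ^ (-1 - ε))
    (A B : ℝ) (hA : 0 < A) (hAB : A ≤ B)
    (hsum : ∀ᵐ t : ℝ, ENNReal.ofReal A ≤ ∑' m : ℤ, ‖θ (t - m)‖ₑ ^ 2 ∧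
      ∑' m : ℤ, ‖θ (t - m)‖ₑ ^ 2 ≤ ENNReal.ofReal B) :
    (∀ (v : ℝ → ℝ) (C : ℝ),
      WarpedFilterBank.IsModerateWith (WarpedFilterBank.warpWeight D F) v C →
      ∀ atil : ℝ, 0 < atil →
        ∃ h : ∀ m, MemLp (WarpedFilterBank.warpedResponse D F θ
            (WarpedFilterBank.naturalFactors v C atil) m) 2 volume,
          WarpedFilterBank.IsBesselSequence (WarpedFilterBank.signalSpace D)
            (WarpedFilterBank.warpedFilterBank D F θ
              (WarpedFilterBank.naturalFactors v C atil) h)) ∧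
    (∃ a₀ : ℝ, 0 < a₀ ∧ ∀ (v : ℝ → ℝ) (C : ℝ),
      WarpedFilterBank.IsModerateWith (WarpedFilterBank.warpWeight D F) v C →
      ∀ atil : ℝ, 0 < atil → atil ≤ a₀ →
        ∃ h : ∀ m, MemLp (WarpedFilterBank.warpedResponse D F θ
            (WarpedFilterBank.naturalFactors v C atil) m) 2 volume,
          WarpedFilterBank.IsFrame (WarpedFilterBank.signalSpace D)
            (WarpedFilterBank.warpedFilterBank D F θ
              (WarpedFilterBank.naturalFactors v C atil) h)) := by
  obtain ⟨K, hK, hdec⟩ := exists_decayAt hF hε hθ₁ hθ₂ (hsum.mono fun t h => h.2)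
  have hB : 0 < B := hA.trans_le hAB
  refine ⟨fun v C hv b hb => ?_, ?_⟩
  · refine ⟨fun m => memLp_warpedResponse hF hθ hK.le hε hdec hv _ m,
      warpedFilterBank_mem_signalSpace _, B + (offDiagBound K ε b).toReal, by positivity,
      fun f hf => ?_⟩
    rw [ENNReal.ofReal_mul (by positivity), ENNReal.ofReal_add hB.le ENNReal.toReal_nonneg,
      ENNReal.ofReal_toReal (offDiagBound_ne_top K hε b)]
    exact (warpedFilterBank_bounds hF hK.le hε hdec hsum hv hb _ hf).1
  · obtain ⟨a₀, ha₀, hbound⟩ := exists_offDiagBound_le K hε (half_pos hA)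
    refine ⟨a₀, ha₀, fun v C hv b hb hba => ?_⟩
    refine ⟨fun m => memLp_warpedResponse hF hθ hK.le hε hdec hv _ m,
      warpedFilterBank_mem_signalSpace _, A / 2, B + A / 2, half_pos hA, by linarith,
      fun f hf => ?_⟩
    obtain ⟨hu, hl⟩ := warpedFilterBank_bounds hF hK.le hε hdec hsum hv hb
      (fun m => memLp_warpedResponse hF hθ hK.le hε hdec hv _ m) hf
    have hR := hbound b hb hba
    constructor
    · have h1 : ENNReal.ofReal (A / 2 * ‖f‖ ^ 2) + ENNReal.ofReal (A / 2 * ‖f‖ ^ 2) =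
          ENNReal.ofReal A * ENNReal.ofReal (‖f‖ ^ 2) := by
        rw [← ENNReal.ofReal_add (by positivity) (by positivity), ← ENNReal.ofReal_mul hA.le]
        congr 1
        ring
      -- Adding the finite quantity `A / 2 * ‖f‖ ^ 2` to both sides replaces the subtraction of the
      -- off-diagonal part.
      refine (ENNReal.add_le_add_iff_right (ENNReal.ofReal_ne_top (r := A / 2 * ‖f‖ ^ 2))).mp ?_
      rw [h1]
      refine hl.trans ?_
      rw [ENNReal.ofReal_mul (by positivity)]
      gcongr
    · rw [ENNReal.ofReal_mul (by positivity), ENNReal.ofReal_add hB.le (half_pos hA).le]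
      exact hu.trans (by gcongr)
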